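/- Let $T$ be an integral domain, $M$ a nonzero maximal ideal of $T$, $k=T/M$, $\varphi:T\to k$ the canonical projection, $D$ a proper subring of $k$, and $R=\varphi^{-1}(D)$; let $K$ be the common quotient field of $R$ and $T$. For an integral domain $A$ with quotient field $F$ and a nonzero fractional ideal $E$ of $A$, put $E^{-1}=(A:_F E)=\{x\in F\mid xE\subseteq A\}$. For a star operation $\star$ on $A$, let $E^{\star_f}$ be the union of the $G^{\star}$ over all nonzero finitely generated $A$-submodules $G\subseteq E$, and let $E^{\widetilde{\star}}=\bigcap_P EA_P$, where $P$ runs over the maximal elements of the set of nonzero proper integral ideals $I$ of $A$ with $I^{\star_f}=I$ (these are prime ideals; the empty intersection is $F$). Let $v_A$ be the operation $E^{v_A}=(E^{-1})^{-1}$, and $t_A=(v_A)_f$, $w_A=\widetilde{v_A}$. The domain $A$ is a P$\star$MD if $(II^{-1})^{\star_f}=A$ for every nonzero finitely generated fractional ideal $I$ of $A$. For a star operation $\ast$ on $R$, its extension to $T$ is defined by $E^{(\ast)_T}=E^{\ast}\cap E^{v_T}$ for each nonzero fractional ideal $E$ of $T$. Then $R$ is a P$v_R$MD if and only if all of the following hold: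 $k$ is the quotient field of $D$; $D$ is a P$v_D$MD; $T$ is a P$(v_R)_T$MD; and the localization $T_M$ is a valuation domain. Moreover: - $R$ is a P$v_R$MD $\iff$ $R$ is a P$t_R$MD $\iff$ $R$ is a P$w_R$MD; - $D$ is a P$v_D$MD $\iff$ $D$ is a P$t_D$MD $\iff$ $D$ is a P$w_D$MD; - $T$ is a P$(v_R)_T$MD $\iff$ $T$ is a P$(t_R)_T$MD $\iff$ $T$ is a P$(w_R)_T$MD. -/

import Mathlib

open scoped nonZeroDivisors

/-! Throughout, `A` is an integral domain with quotient field `K`, the fractional ideals of `A`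
are `A`-submodules of `K`, and a star operation `⋆` on `A` is handled through the underlying
sets of its values: `star E` is the subset `E^⋆` of `K`. In `Submodule A K`, `1` is (the image
of) `A` and `1 / E` is `E⁻¹ = (A :_K E) = {x ∈ K | x E ⊆ A}`. -/

section StarOperations

variable (A K : Type*) [CommRing A] [Field K] [Algebra A K]

/-- The `v`-operation: `E^v = (E⁻¹)⁻¹ = (A :_K (A :_K E))`. -/
def vOp (E : Submodule A K) : Set K :=
  ((1 / (1 / E) : Submodule A K) : Set K)

variable {A K}

/-- The operation of finite type `⋆_f` attached to `⋆`: `E^{⋆_f}` is the union of the `F^⋆`,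
`F` ranging over the nonzero finitely generated `A`-submodules of `K` contained in `E`. -/
def finType (star : Submodule A K → Set K) (E : Submodule A K) : Set K :=
  {x | ∃ F : Submodule A K, F ≠ ⊥ ∧ F.FG ∧ F ≤ E ∧ x ∈ star F}

/-- A nonzero proper integral ideal `I` of `A` with `I^⋆ = I`. -/
def IsProperStarIdeal (star : Submodule A K → Set K) (I : Ideal A) : Prop :=
  I ≠ ⊥ ∧ I ≠ ⊤ ∧ star (IsLocalization.coeSubmodule K I) = IsLocalization.coeSubmodule K I

/-- `P ∈ Max^⋆(A)`: a maximal element among the proper `⋆`-ideals of `A`. -/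
def IsMaximalStarIdeal (star : Submodule A K → Set K) (P : Ideal A) : Prop :=
  Maximal (IsProperStarIdeal star) P

/-- `E A_P ⊆ K`, for a prime ideal `P` of `A`: the `x ∈ K` with `s x ∈ E` for some `s ∈ A ∖ P`. -/
def localizedAt (P : Ideal A) (E : Submodule A K) : Set K :=
  {x | ∃ s : A, s ∉ P ∧ s • x ∈ E}

/-- The stable operation of finite type attached to `⋆`: `E^{⋆~} = ⋂ E A_P`, over the prime
ideals `P ∈ Max^{⋆_f}(A)`. -/
def stableFinType (star : Submodule A K → Set K) (E : Submodule A K) : Set K :=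
  {x | ∀ P : Ideal A, P.IsPrime → IsMaximalStarIdeal (finType star) P → x ∈ localizedAt P E}

variable (A K)

/-- The `t`-operation `t = v_f`. -/
def tOp : Submodule A K → Set K := finType (vOp A K)

/-- The `w`-operation, i.e. the stable operation of finite type attached to `v`. -/
def wOp : Submodule A K → Set K := stableFinType (vOp A K)

variable {A K}

/-- `A` is a `P⋆MD`: `(I I⁻¹)^{⋆_f} = A` for every nonzero finitely generated fractional ideal
`I` of `A`. (Finitely generated submodules of the quotient field are fractional ideals.) -/
def IsPStarMD (star : Submodule A K → Set K) : Prop :=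
  ∀ I : Submodule A K, I ≠ ⊥ → I.FG → finType star (I * (1 / I)) = (1 : Submodule A K)

end StarOperations

/-- The extension `(⋆)_T` to the overring `T ⊆ K` of `R` of an operation `⋆` on `R`:
`E^{(⋆)_T} = E^⋆ ∩ E^{v_T}` for `E` a fractional ideal of `T`, regarded in `E^⋆` as an
`R`-submodule of `K`. -/
def extendOp {R : Type*} (T : Type*) {K : Type*} [CommRing R] [CommRing T] [Field K]
    [Algebra R T] [Algebra R K] [Algebra T K] [IsScalarTower R T K]
    (star : Submodule R K → Set K) (E : Submodule T K) : Set K :=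
  star (E.restrictScalars R) ∩ vOp T K E

/-- The pullback `R = φ⁻¹(D) ⊆ T`, where `φ : T → T/M` is the canonical projection. -/
abbrev pullbackRing {T : Type*} [CommRing T] (M : Ideal T) (D : Subring (T ⧸ M)) : Subring T :=
  D.comap (Ideal.Quotient.mk M)

/-- `R` and `T` have the same quotient field `K`. -/
theorem pullbackRing_isFractionRing {T K : Type*} [CommRing T] [IsDomain T] [Field K]
    [Algebra T K] [IsFractionRing T K] (M : Ideal T) (hM0 : M ≠ ⊥) (D : Subring (T ⧸ M)) :
    IsFractionRing (pullbackRing M D) K := by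
  obtain ⟨m, hm, hm0⟩ := Submodule.exists_mem_ne_zero_of_ne_bot hM0
  have hmem : ∀ x ∈ M, x ∈ pullbackRing M D := fun x hx => by
    simp [pullbackRing, Subring.mem_comap, Ideal.Quotient.eq_zero_iff_mem.mpr hx, D.zero_mem]
  have hinj : ∀ x : pullbackRing M D, algebraMap (pullbackRing M D) K x = algebraMap T K x :=
    fun _ => rfl
  have hT := IsFractionRing.injective T K
  refine ⟨⟨?_, ?_, ?_⟩⟩
  · intro y
    rw [hinj, isUnit_iff_ne_zero]
    intro h
    have h0 : ((y : pullbackRing M D) : T) = 0 := hT (by simpa using h)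
    exact nonZeroDivisors.ne_zero y.2 (Subtype.ext h0)
  · intro z
    obtain ⟨a, b, hb, rfl⟩ := IsFractionRing.div_surjective (A := T) z
    have hb0 := nonZeroDivisors.ne_zero hb
    refine ⟨(⟨m * a, hmem _ (M.mul_mem_right a hm)⟩,
      ⟨⟨m * b, hmem _ (M.mul_mem_right b hm)⟩, mem_nonZeroDivisors_of_ne_zero ?_⟩), ?_⟩
    · intro h
      exact mul_ne_zero hm0 hb0 (congrArg Subtype.val h)
    · have : algebraMap T K b ≠ 0 := fun h => hb0 (hT (by rw [h, map_zero]))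
      rw [hinj, hinj]
      simp only [map_mul]
      field_simp
  · intro x y h
    refine ⟨1, ?_⟩
    rw [hinj, hinj] at h
    have := Subtype.ext (hT h)
    simp [this]

/-! For a finitely generated nonzero ideal `J` of `A`, each of `1 ∈ J^v`, `1 ∈ J^t`, `1 ∈ J^w` means
that `J` is a Glaz–Vasconcelos (GV) ideal. So for `⋆ = v, t, w` the P⋆MD property has one and the
same form: every `I I⁻¹`, with `I` finitely generated, contains a GV ideal
(`isPStarMD_iff_isGVIdeal`). For the extensions to `T` the common form asks for a GV ideal of `T`
not contained in `M` (`isPStarMD_extendOp_iff`).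

The equivalence then reduces to moving GV ideals around the pullback. A GV ideal of `R` is not
contained in `M`; it extends to a GV ideal of `T` and maps onto a GV ideal of `D`. Conversely, a GV
ideal `H` of `D` and a GV ideal `G ⊄ M` of `T` are glued into a GV ideal of `R`, generated by lifts
of generators of `H` and by `m` times generators of `G`, with `m ∈ M` congruent to 1 modulo a lift
of a nonzero element of `H`. The valuation property of `T_M` follows from the condition on `T`: an
ideal `(a, b)` with `I I⁻¹ ⊄ M` is principal at `M`. -/

set_option linter.unusedSectionVars false

/-! ### GV ideals and the common criterion for the operations `v`, `t`, `w`. -/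

section GlazVasconcelos

variable {A : Type*} (K : Type*) [CommRing A] [Field K] [Algebra A K]

/-- A Glaz–Vasconcelos ideal: a nonzero finitely generated ideal `J` of `A` with
`(A :_K J) = A`. -/
structure IsGVIdeal (J : Ideal A) : Prop where
  ne_bot : J ≠ ⊥
  fg : J.FG
  mem_one : ∀ x : K, (∀ a ∈ J, x * algebraMap A K a ∈ (1 : Submodule A K)) →
    x ∈ (1 : Submodule A K)

variable {K}

theorem algebraMap_mem_submoduleOne (a : A) : algebraMap A K a ∈ (1 : Submodule A K) :=
  Submodule.mem_one.2 ⟨a, rfl⟩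

theorem mul_algebraMap_mem {E : Submodule A K} {x : K} (hx : x ∈ E) (a : A) :
    x * algebraMap A K a ∈ E := by
  rw [mul_comm, ← Algebra.smul_def]
  exact E.smul_mem a hx

theorem mem_vOp {E : Submodule A K} {x : K} :
    x ∈ vOp A K E ↔ ∀ y : K, (∀ e ∈ E, y * e ∈ (1 : Submodule A K)) →
      x * y ∈ (1 : Submodule A K) := by
  simp only [vOp, SetLike.mem_coe, Submodule.mem_div_iff_forall_mul_mem]

theorem one_mem_vOp {E : Submodule A K} :
    (1 : K) ∈ vOp A K E ↔ ∀ y : K, (∀ e ∈ E, y * e ∈ (1 : Submodule A K)) →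
      y ∈ (1 : Submodule A K) := by
  simp only [mem_vOp, one_mul]

theorem subset_vOp {E : Submodule A K} {x : K} (hx : x ∈ E) : x ∈ vOp A K E :=
  mem_vOp.2 fun y hy => by rw [mul_comm]; exact hy x hx

theorem vOp_mono {E F : Submodule A K} (h : E ≤ F) : vOp A K E ⊆ vOp A K F := fun _ hx =>
  mem_vOp.2 fun y hy => mem_vOp.1 hx y fun e he => hy e (h he)

theorem vOp_subset_one {E : Submodule A K} (h : E ≤ 1) :
    vOp A K E ⊆ (1 : Submodule A K) := fun x hx => by
  simpa using mem_vOp.1 hx 1 fun e he => by simpa using h he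

theorem mul_mem_vOp {E : Submodule A K} {x : K} (hx : x ∈ vOp A K E) (a : A) :
    x * algebraMap A K a ∈ vOp A K E := by
  have := Submodule.smul_mem _ a (show x ∈ (1 / (1 / E) : Submodule A K) from hx)
  rw [mul_comm, ← Algebra.smul_def]
  exact this

theorem coeSubmodule_le_one (J : Ideal A) : IsLocalization.coeSubmodule K J ≤ 1 := by
  intro x hx
  obtain ⟨a, -, rfl⟩ := (IsLocalization.mem_coeSubmodule K J).1 hx
  exact algebraMap_mem_submoduleOne a

theorem forall_mem_coeSubmodule {J : Ideal A} {p : K → Prop} :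
    (∀ x ∈ IsLocalization.coeSubmodule K J, p x) ↔ ∀ a ∈ J, p (algebraMap A K a) := by
  simp only [IsLocalization.mem_coeSubmodule]
  exact ⟨fun h a ha => h _ ⟨a, ha, rfl⟩, by rintro h _ ⟨a, ha, rfl⟩; exact h a ha⟩

theorem one_mem_vOp_coeSubmodule {J : Ideal A} (h0 : J ≠ ⊥) (hfg : J.FG) :
    (1 : K) ∈ vOp A K (IsLocalization.coeSubmodule K J) ↔ IsGVIdeal K J := by
  simp only [one_mem_vOp, forall_mem_coeSubmodule]
  exact ⟨fun h => ⟨h0, hfg, h⟩, fun h => h.mem_one⟩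

theorem fg_coeSubmodule {J : Ideal A} (hJ : J.FG) : (IsLocalization.coeSubmodule K J).FG :=
  Submodule.FG.map _ hJ

theorem coeSubmodule_comap {F : Submodule A K} (hF : F ≤ 1) :
    IsLocalization.coeSubmodule K (F.comap (Algebra.linearMap A K)) = F := by
  ext x
  simp only [IsLocalization.mem_coeSubmodule, Submodule.mem_comap, Algebra.linearMap_apply]
  constructor
  · rintro ⟨a, ha, rfl⟩
    exact ha
  · intro hx
    obtain ⟨a, rfl⟩ := Submodule.mem_one.1 (hF hx)
    exact ⟨a, hx, rfl⟩

theorem coeSubmodule_ne_bot [IsFractionRing A K] {J : Ideal A} (hJ : J ≠ ⊥) :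
    IsLocalization.coeSubmodule K J ≠ ⊥ := by
  obtain ⟨a, ha, h0⟩ := Submodule.exists_mem_ne_zero_of_ne_bot hJ
  refine (Submodule.ne_bot_iff _).2 ⟨algebraMap A K a, ?_, ?_⟩
  · exact (IsLocalization.mem_coeSubmodule K J).2 ⟨a, ha, rfl⟩
  · simpa using h0

theorem fg_comap_of_le_one [IsFractionRing A K] {F : Submodule A K} (hF : F ≤ 1) (hfg : F.FG) :
    (F.comap (Algebra.linearMap A K)).FG := by
  apply Submodule.fg_of_fg_map_injective (Algebra.linearMap A K)
    (IsFractionRing.injective A K)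
  have := coeSubmodule_comap hF
  rw [IsLocalization.coeSubmodule] at this
  rwa [this]

theorem tOp_subset_vOp (E : Submodule A K) : tOp A K E ⊆ vOp A K E := by
  rintro x ⟨F, -, -, hF, hx⟩
  exact vOp_mono hF hx

theorem mul_mem_tOp {E : Submodule A K} {x : K} (hx : x ∈ tOp A K E) (a : A) :
    x * algebraMap A K a ∈ tOp A K E := by
  obtain ⟨F, h0, hfg, hF, hx⟩ := hx
  exact ⟨F, h0, hfg, hF, mul_mem_vOp hx a⟩

theorem mul_mem_wOp {E : Submodule A K} {x : K} (hx : x ∈ wOp A K E) (a : A) :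
    x * algebraMap A K a ∈ wOp A K E := by
  intro P hP hmax
  obtain ⟨s, hs, hsx⟩ := hx P hP hmax
  refine ⟨s, hs, ?_⟩
  rw [← smul_mul_assoc]
  exact mul_algebraMap_mem hsx a

/-- `P⋆MD`s in terms of finitely generated integral ideals. -/
theorem isPStarMD_iff [IsFractionRing A K] {star : Submodule A K → Set K}
    (hle : ∀ F : Submodule A K, F ≠ ⊥ → F.FG → F ≤ 1 → star F ⊆ (1 : Submodule A K))
    (hmul : ∀ F : Submodule A K, 1 ∈ star F → ∀ a : A, algebraMap A K a ∈ star F) :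
    IsPStarMD star ↔ ∀ I : Submodule A K, I ≠ ⊥ → I.FG → ∃ J : Ideal A, J ≠ ⊥ ∧ J.FG ∧
      IsLocalization.coeSubmodule K J ≤ I * (1 / I) ∧
      1 ∈ star (IsLocalization.coeSubmodule K J) := by
  refine forall_congr' fun I => forall_congr' fun _ => forall_congr' fun _ => ?_
  constructor
  · intro h
    have h1 : (1 : K) ∈ finType star (I * (1 / I)) := by
      rw [h]; exact Submodule.one_le.1 le_rfl
    obtain ⟨F, hF0, hFfg, hF, h1⟩ := h1
    have hF1 := hF.trans Submodule.mul_one_div_le_one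
    have hc := coeSubmodule_comap hF1
    refine ⟨F.comap (Algebra.linearMap A K), ?_, fg_comap_of_le_one hF1 hFfg, ?_, ?_⟩
    · intro hb
      rw [hb] at hc
      exact hF0 (by simpa [eq_comm] using hc)
    · rwa [hc]
    · rwa [hc]
  · rintro ⟨J, h0, hfg, hle', h1⟩
    apply Set.Subset.antisymm
    · rintro x ⟨F, hF0, hFfg, hF, hx⟩
      exact hle F hF0 hFfg (hF.trans Submodule.mul_one_div_le_one) hx
    · intro x hx
      obtain ⟨a, rfl⟩ := Submodule.mem_one.1 hx
      exact ⟨_, coeSubmodule_ne_bot h0, fg_coeSubmodule hfg, hle', hmul _ h1 a⟩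

/-- Keeps only the `P`-components of finitely many generators, so that a GV ideal inside `P + (a)`
involves finitely many elements of `P`. -/
theorem exists_fg_le_of_fg_le_sup {J P : Ideal A} {a : A} (hJ : J.FG)
    (h : J ≤ P ⊔ Ideal.span {a}) : ∃ P' ≤ P, P'.FG ∧ J ≤ P' ⊔ Ideal.span {a} := by
  classical
  obtain ⟨s, rfl⟩ := hJ
  have h' : ∀ g : s, ∃ p ∈ P, ∃ q ∈ Ideal.span {a}, p + q = (g : A) := fun g =>
    Submodule.mem_sup.1 (h (Submodule.subset_span g.2))
  choose p hp q hq hpq using h'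
  refine ⟨Ideal.span (Set.range p), Ideal.span_le.2 ?_,
    Submodule.fg_span (Set.finite_range p), Submodule.span_le.2 ?_⟩
  · rintro _ ⟨g, rfl⟩
    exact hp g
  · intro g hg
    rw [SetLike.mem_coe, show g = _ from (hpq ⟨g, hg⟩).symm]
    exact Submodule.add_mem_sup (Ideal.subset_span ⟨_, rfl⟩) (hq _)

variable [IsDomain A]

theorem IsGVIdeal.mul {J J' : Ideal A} (hJ : IsGVIdeal K J) (hJ' : IsGVIdeal K J') :
    IsGVIdeal K (J * J') := by
  refine ⟨mul_ne_zero hJ.ne_bot hJ'.ne_bot, hJ.fg.mul hJ'.fg, fun x hx => ?_⟩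
  refine hJ.mem_one x fun a ha => hJ'.mem_one _ fun b hb => ?_
  rw [mul_assoc, ← map_mul]
  exact hx _ (Ideal.mul_mem_mul ha hb)

theorem isGVIdeal_top : IsGVIdeal K (⊤ : Ideal A) :=
  ⟨top_ne_bot, ⟨{1}, by simp⟩, fun x hx => by simpa using hx 1 trivial⟩

variable [IsFractionRing A K]

theorem IsGVIdeal.not_le_of_isProperStarIdeal {J P : Ideal A} (hJ : IsGVIdeal K J)
    (hP : IsProperStarIdeal (finType (vOp A K)) P) : ¬ J ≤ P := by
  intro h
  apply hP.2.1
  have h1 : (1 : K) ∈ finType (vOp A K) (IsLocalization.coeSubmodule K P) :=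
    ⟨_, coeSubmodule_ne_bot hJ.ne_bot, fg_coeSubmodule hJ.fg,
      IsLocalization.coeSubmodule_mono K h, (one_mem_vOp_coeSubmodule hJ.ne_bot hJ.fg).2 hJ⟩
  rw [hP.2.2] at h1
  obtain ⟨a, ha, ha1⟩ := (IsLocalization.mem_coeSubmodule K P).1 h1
  rw [Ideal.eq_top_iff_one]
  rw [← map_one (algebraMap A K), (IsFractionRing.injective A K).eq_iff] at ha1
  exact ha1 ▸ ha

/-- A nonzero ideal containing no Glaz–Vasconcelos ideal lies in a prime maximal `t`-ideal. -/
theorem exists_isMaximalStarIdeal {I : Ideal A} (hI : I ≠ ⊥)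
    (h : ∀ J, IsGVIdeal K J → ¬ J ≤ I) :
    ∃ P : Ideal A, I ≤ P ∧ P.IsPrime ∧ IsMaximalStarIdeal (finType (vOp A K)) P := by
  obtain ⟨P, hIP, hP, hmax⟩ := zorn_le_nonempty₀ {P : Ideal A | ∀ J, IsGVIdeal K J → ¬ J ≤ P}
    (fun c hc hch y hy => ⟨sSup c, fun J hJ hle => by
      -- A GV ideal is finitely generated, so if it lies in the union of a chain it lies in one
      -- member.
      obtain ⟨Q, hQ, hJQ⟩ := (Submodule.fg_iff_compact J).1 hJ.fg c (sSup c) ⟨y, hy⟩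
        hch.directedOn (isLUB_sSup c) hle
      exact hc hQ J hJ hJQ, fun z hz => le_sSup hz⟩) I h
  have hP0 : P ≠ ⊥ := fun hb => hI (le_bot_iff.1 (hb ▸ hIP))
  have hex : ∀ a ∉ P, ∃ J, IsGVIdeal K J ∧ J ≤ P ⊔ Ideal.span {a} := by
    intro a ha
    by_contra! hc
    exact ha (hmax hc le_sup_left (Ideal.mem_sup_right (Ideal.mem_span_singleton_self a)))
  have hprime : P.IsPrime := by
    refine ⟨fun ht => hP ⊤ isGVIdeal_top (ht ▸ le_rfl), fun {a b} hab => ?_⟩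
    by_contra! hc
    obtain ⟨J, hJ, hle⟩ := hex a hc.1
    obtain ⟨J', hJ', hle'⟩ := hex b hc.2
    refine hP _ (hJ.mul hJ') ((Ideal.mul_mono hle hle').trans ?_)
    rw [Ideal.sup_mul, Ideal.mul_sup (Ideal.span {a}), Ideal.span_singleton_mul_span_singleton]
    refine sup_le Ideal.mul_le_left (sup_le Ideal.mul_le_right ?_)
    simpa [Ideal.span_le] using hab
  refine ⟨P, hIP, hprime, ⟨hP0, hprime.ne_top, ?_⟩, fun Q hQ hPQ =>
    hmax (fun J hJ => hJ.not_le_of_isProperStarIdeal hQ) hPQ⟩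
  apply Set.Subset.antisymm
  · rintro x ⟨F, hF0, hFfg, hF, hx⟩
    have hF1 := hF.trans (coeSubmodule_le_one P)
    obtain ⟨a, rfl⟩ := Submodule.mem_one.1 (vOp_subset_one hF1 hx)
    by_contra hna
    have ha : a ∉ P := fun ha => hna ((IsLocalization.mem_coeSubmodule K P).2 ⟨a, ha, rfl⟩)
    obtain ⟨J, hJ, hle⟩ := hex a ha
    obtain ⟨P', hP', hP'fg, hJP'⟩ := exists_fg_le_of_fg_le_sup hJ.fg hle
    set F' : Ideal A := F.comap (Algebra.linearMap A K) with hF'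
    have hFP : F' ≤ P := fun b hb => by
      obtain ⟨p, hp, hpb⟩ := (IsLocalization.mem_coeSubmodule K P).1 (hF hb)
      rw [Algebra.linearMap_apply, (IsFractionRing.injective A K).eq_iff] at hpb
      exact hpb ▸ hp
    have hF'0 : F' ≠ ⊥ := fun hb => hF0 (by rw [← coeSubmodule_comap hF1, ← hF', hb]; simp)
    -- `F' + P' ⊆ P` would be a GV ideal: if `y` sends it into `A`, then `ya ∈ A` because `a ∈ F^v`,
    -- so `y` sends `P' + (a) ⊇ J` into `A`.
    refine hP (F' ⊔ P') ⟨fun hb => hF'0 (le_bot_iff.1 (hb ▸ le_sup_left)),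
      (fg_comap_of_le_one hF1 hFfg).sup hP'fg, fun y hy => ?_⟩ (sup_le hFP hP')
    have hya : algebraMap A K a * y ∈ (1 : Submodule A K) := mem_vOp.1 hx y fun e he => by
      obtain ⟨b, rfl⟩ := Submodule.mem_one.1 (hF1 he)
      exact hy b (Ideal.mem_sup_left he)
    refine hJ.mem_one y fun j hj => ?_
    obtain ⟨p, hp, q, hq, rfl⟩ := Submodule.mem_sup.1 (hJP' hj)
    obtain ⟨r, rfl⟩ := Ideal.mem_span_singleton'.1 hq
    rw [map_add, mul_add]
    refine add_mem (hy p (Ideal.mem_sup_right hp)) ?_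
    rw [map_mul, show y * (algebraMap A K r * algebraMap A K a) =
      (algebraMap A K a * y) * algebraMap A K r by ring]
    exact mul_algebraMap_mem hya r
  · intro x hx
    obtain ⟨a, ha, rfl⟩ := (IsLocalization.mem_coeSubmodule K P).1 hx
    obtain ⟨b, hb, hb0⟩ := Submodule.exists_mem_ne_zero_of_ne_bot hP0
    -- The nonzero `b` is added because `finType` admits only nonzero submodules and `a` may be 0.
    refine ⟨IsLocalization.coeSubmodule K (Ideal.span {a, b}), coeSubmodule_ne_bot ?_,
      fg_coeSubmodule (Submodule.fg_span (by simp)), IsLocalization.coeSubmodule_mono K ?_,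
      subset_vOp ((IsLocalization.mem_coeSubmodule K _).2
        ⟨a, Ideal.subset_span (by simp), rfl⟩)⟩
    · exact (Submodule.ne_bot_iff _).2 ⟨b, Ideal.subset_span (by simp), hb0⟩
    · rw [Ideal.span_le]
      rintro z (rfl | rfl)
      exacts [ha, hb]

/-- The ideal of all `a` with `xa ∈ E` is nonzero since `E` is. Without a GV ideal inside it, it
would lie in some prime maximal `t`-ideal `P`, against `x ∈ E A_P`. Conversely, no proper `t`-ideal
contains a GV ideal. -/
theorem mem_wOp {E : Submodule A K} (hE : E ≠ ⊥) {x : K} :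
    x ∈ wOp A K E ↔ ∃ J : Ideal A, IsGVIdeal K J ∧ ∀ a ∈ J, x * algebraMap A K a ∈ E := by
  constructor
  · intro hx
    set I : Ideal A := E.comap (LinearMap.toSpanSingleton A K x) with hI
    have hmem : ∀ a, a ∈ I ↔ x * algebraMap A K a ∈ E := fun a => by
      rw [hI, Submodule.mem_comap, LinearMap.toSpanSingleton_apply, Algebra.smul_def, mul_comm]
    have hI0 : I ≠ ⊥ := by
      obtain ⟨e, he, he0⟩ := Submodule.exists_mem_ne_zero_of_ne_bot hE
      obtain ⟨n, d, hd, rfl⟩ := IsFractionRing.div_surjective (A := A) x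
      obtain ⟨n', d', hd', rfl⟩ := IsFractionRing.div_surjective (A := A) e
      have h0 := nonZeroDivisors.ne_zero hd
      have h0' := nonZeroDivisors.ne_zero hd'
      have hK : algebraMap A K d ≠ 0 := by simpa using h0
      have hK' : algebraMap A K d' ≠ 0 := by simpa using h0'
      refine (Submodule.ne_bot_iff _).2 ⟨d * n', (hmem _).2 ?_, mul_ne_zero h0 ?_⟩
      · convert mul_algebraMap_mem he (n * d') using 1
        simp only [map_mul]
        field_simp
      · rintro rfl
        simp at he0
    by_contra! hc
    obtain ⟨P, hIP, hP, hmax⟩ := exists_isMaximalStarIdeal (K := K) hI0 fun J hJ hle => by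
      obtain ⟨a, ha, hna⟩ := hc J hJ
      exact hna ((hmem a).1 (hle ha))
    obtain ⟨s, hs, hsx⟩ := hx P hP hmax
    exact hs (hIP hsx)
  · rintro ⟨J, hJ, hJE⟩ P _ hmax
    obtain ⟨s, hs, hsP⟩ := Set.not_subset.1 (hJ.not_le_of_isProperStarIdeal hmax.1)
    refine ⟨s, hsP, ?_⟩
    rw [Algebra.smul_def, mul_comm]
    exact hJE s hs

theorem one_mem_tOp_of_one_mem_wOp {E : Submodule A K} (hE : E ≠ ⊥) (h : 1 ∈ wOp A K E) :
    1 ∈ tOp A K E := by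
  obtain ⟨J, hJ, hJE⟩ := (mem_wOp hE).1 h
  exact ⟨_, coeSubmodule_ne_bot hJ.ne_bot, fg_coeSubmodule hJ.fg,
    forall_mem_coeSubmodule.2 fun a ha => by simpa using hJE a ha,
    (one_mem_vOp_coeSubmodule hJ.ne_bot hJ.fg).2 hJ⟩

theorem wOp_subset_one {E : Submodule A K} (h0 : E ≠ ⊥) (h : E ≤ 1) :
    wOp A K E ⊆ (1 : Submodule A K) := by
  intro x hx
  obtain ⟨J, hJ, hJE⟩ := (mem_wOp h0).1 hx
  exact hJ.mem_one x fun a ha => h (hJE a ha)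

theorem isPStarMD_iff_isGVIdeal {star : Submodule A K → Set K}
    (hle : ∀ F : Submodule A K, F ≠ ⊥ → F.FG → F ≤ 1 → star F ⊆ (1 : Submodule A K))
    (hmul : ∀ F : Submodule A K, 1 ∈ star F → ∀ a : A, algebraMap A K a ∈ star F)
    (hone : ∀ J : Ideal A, J ≠ ⊥ → J.FG →
      (1 ∈ star (IsLocalization.coeSubmodule K J) ↔ IsGVIdeal K J)) :
    IsPStarMD star ↔ ∀ I : Submodule A K, I ≠ ⊥ → I.FG → ∃ J : Ideal A, IsGVIdeal K J ∧
      ∀ a ∈ J, algebraMap A K a ∈ I * (1 / I) := by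
  rw [isPStarMD_iff hle hmul]
  refine forall_congr' fun I => forall_congr' fun _ => forall_congr' fun _ =>
    exists_congr fun J => ?_
  rw [SetLike.le_def, forall_mem_coeSubmodule]
  exact ⟨fun ⟨h0, hfg, hle, h1⟩ => ⟨(hone J h0 hfg).1 h1, hle⟩,
    fun ⟨h, hle⟩ => ⟨h.ne_bot, h.fg, hle, (hone J h.ne_bot h.fg).2 h⟩⟩

theorem isPStarMD_vOp_iff : IsPStarMD (vOp A K) ↔
    ∀ I : Submodule A K, I ≠ ⊥ → I.FG → ∃ J : Ideal A, IsGVIdeal K J ∧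
      ∀ a ∈ J, algebraMap A K a ∈ I * (1 / I) :=
  isPStarMD_iff_isGVIdeal (fun _ _ _ h => vOp_subset_one h)
    (fun _ h a => by simpa using mul_mem_vOp h a) fun _ h0 hfg => one_mem_vOp_coeSubmodule h0 hfg

theorem isPStarMD_vOp_iff_tOp : IsPStarMD (vOp A K) ↔ IsPStarMD (tOp A K) := by
  rw [isPStarMD_vOp_iff, isPStarMD_iff_isGVIdeal (star := tOp A K)
    (fun F _ _ h => (tOp_subset_vOp F).trans (vOp_subset_one h))
    (fun _ h a => by simpa using mul_mem_tOp h a)]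
  intro J h0 hfg
  rw [← one_mem_vOp_coeSubmodule h0 hfg]
  exact ⟨fun h => tOp_subset_vOp _ h,
    fun h => ⟨_, coeSubmodule_ne_bot h0, fg_coeSubmodule hfg, le_rfl, h⟩⟩

theorem isPStarMD_vOp_iff_wOp : IsPStarMD (vOp A K) ↔ IsPStarMD (wOp A K) := by
  rw [isPStarMD_vOp_iff, isPStarMD_iff_isGVIdeal (star := wOp A K)
    (fun F h0 _ h => wOp_subset_one h0 h) (fun _ h a => by simpa using mul_mem_wOp h a)]
  intro J h0 hfg
  constructor
  · intro h
    exact (one_mem_vOp_coeSubmodule h0 hfg).1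
      (tOp_subset_vOp _ (one_mem_tOp_of_one_mem_wOp (coeSubmodule_ne_bot h0) h))
  · intro h
    refine (mem_wOp (coeSubmodule_ne_bot h0)).2 ⟨J, h, fun a ha => ?_⟩
    rw [one_mul]
    exact (IsLocalization.mem_coeSubmodule K J).2 ⟨a, ha, rfl⟩

/-- Being a `PvMD` does not depend on the choice of the quotient field. -/
theorem IsPStarMD.vOp_of_algEquiv {L : Type*} [Field L] [Algebra A L] [IsFractionRing A L]
    (e : K ≃ₐ[A] L) (h : IsPStarMD (vOp A K)) : IsPStarMD (vOp A L) := by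
  rw [isPStarMD_vOp_iff] at h ⊢
  intro I hI0 hI
  have hmap : ∀ I : Submodule A L, (I.map e.symm.toLinearMap).map e.toLinearMap = I := by
    intro I
    rw [← Submodule.map_comp]
    convert Submodule.map_id I
    ext
    simp
  have hone : ∀ x : L, x ∈ (1 : Submodule A L) ↔ e.symm x ∈ (1 : Submodule A K) := by
    intro x
    simp only [Submodule.mem_one]
    exact exists_congr fun a => by rw [AlgEquiv.eq_symm_apply, AlgEquiv.commutes]
  obtain ⟨J, hJ, hJI⟩ := h (I.map e.symm.toLinearMap)
    (fun hb => hI0 (by rw [← hmap I, hb, Submodule.map_bot])) (hI.map _)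
  refine ⟨J, ⟨hJ.ne_bot, hJ.fg, fun x hx => ?_⟩, fun a ha => ?_⟩
  · refine (hone x).2 (hJ.mem_one _ fun a ha => ?_)
    simpa using (hone _).1 (hx a ha)
  · have := Submodule.mem_map_of_mem (f := e.toLinearMap) (hJI a ha)
    have hm : ∀ X Y : Submodule A K, (X * Y).map e.toLinearMap =
      X.map e.toLinearMap * Y.map e.toLinearMap := fun X Y => Submodule.map_mul X Y e.toAlgHom
    have h1 : (1 : Submodule A K).map e.toLinearMap = 1 := Submodule.map_one e.toAlgHom
    rw [hm, Submodule.map_div, h1, hmap] at this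
    simpa using this

end GlazVasconcelos

/-! ### GV ideals in the pullback, and the extended operations on `T`. -/

section Pullback

variable {T K k : Type*} [CommRing T] [Field K] [Algebra T K] [Field k] {φ : T →+* k}
  {D : Subring k}

theorem mem_one_comap {x : K} : x ∈ (1 : Submodule (D.comap φ) K) ↔
    ∃ t : T, φ t ∈ D ∧ algebraMap T K t = x := by
  rw [Submodule.mem_one]
  exact ⟨fun ⟨r, hr⟩ => ⟨r, r.2, hr⟩, fun ⟨t, ht, htx⟩ => ⟨⟨t, ht⟩, htx⟩⟩

theorem mem_one_of_mem_one_comap {x : K} (hx : x ∈ (1 : Submodule (D.comap φ) K)) :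
    x ∈ (1 : Submodule T K) := by
  obtain ⟨t, -, rfl⟩ := mem_one_comap.1 hx
  exact algebraMap_mem_submoduleOne t

theorem exists_map_notMem (hφ : Function.Surjective φ) (hD : D ≠ ⊤) : ∃ t, φ t ∉ D := by
  by_contra! h
  refine hD (top_le_iff.1 fun y _ => ?_)
  obtain ⟨t, rfl⟩ := hφ y
  exact h t

theorem exists_one_eq_mul_add (hφ : Function.Surjective φ) {h : T} (hh : φ h ≠ 0) :
    ∃ t m : T, φ m = 0 ∧ h * t + m = 1 := by
  obtain ⟨t, ht⟩ := hφ (φ h)⁻¹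
  exact ⟨t, 1 - h * t, by simp [ht, hh], by ring⟩

/-- If `J = (S)` is a Glaz–Vasconcelos ideal and `(h) + (m) = T`, then `(T : (h) + m J) = T`. -/
theorem mem_one_of_isGVIdeal_span {S : Set T} (hS : IsGVIdeal K (Ideal.span S)) {h t m : T}
    (hm : h * t + m = 1) {x : K} (hxh : x * algebraMap T K h ∈ (1 : Submodule T K))
    (hx : ∀ g ∈ S, x * algebraMap T K (m * g) ∈ (1 : Submodule T K)) :
    x ∈ (1 : Submodule T K) := by
  refine hS.mem_one x fun a ha => ?_
  induction ha using Submodule.span_induction with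
  | mem g hg =>
    have : x * algebraMap T K g =
        x * algebraMap T K h * algebraMap T K (t * g) + x * algebraMap T K (m * g) := by
      rw [mul_assoc, ← map_mul, ← mul_add, ← map_add]
      congr 2
      linear_combination -g * hm
    rw [this]
    exact add_mem (mul_algebraMap_mem hxh _) (hx g hg)
  | zero => simp
  | add a b _ _ ha hb => rw [map_add, mul_add]; exact add_mem ha hb
  | smul c a _ ha =>
    rw [smul_eq_mul, map_mul, mul_left_comm, mul_comm]
    exact mul_algebraMap_mem ha c

variable [IsDomain T] [IsFractionRing T K]

theorem algebraMap_mem_one_comap {t : T} :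
    algebraMap T K t ∈ (1 : Submodule (D.comap φ) K) ↔ φ t ∈ D := by
  rw [mem_one_comap]
  refine ⟨fun ⟨t', ht', h⟩ => ?_, fun h => ⟨t, h, rfl⟩⟩
  rwa [← IsFractionRing.injective T K h]

/-- If `E ⊆ ker φ`, any `t ∈ T ∖ R` satisfies `tE ⊆ ker φ ⊆ R`, and `1 ∈ E^v` would force `t ∈ R`.
-/
theorem exists_ne_zero_of_one_mem_vOp (hφ : Function.Surjective φ) (hD : D ≠ ⊤)
    {E : Submodule (D.comap φ) K} (h1 : 1 ∈ vOp (D.comap φ) K E) :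
    ∃ e ∈ E, ∀ t, algebraMap T K t = e → φ t ≠ 0 := by
  by_contra! h
  obtain ⟨t, ht⟩ := exists_map_notMem hφ hD
  refine ht (algebraMap_mem_one_comap.1 (one_mem_vOp.1 h1 (algebraMap T K t) fun e he => ?_))
  obtain ⟨m, rfl, hm⟩ := h e he
  rw [← map_mul]
  exact algebraMap_mem_one_comap.2 (by simp [hm, D.zero_mem])

theorem IsGVIdeal.exists_map_ne_zero (hφ : Function.Surjective φ) (hD : D ≠ ⊤)
    {J : Ideal (D.comap φ)} (hJ : IsGVIdeal K J) : ∃ r ∈ J, φ r ≠ 0 := by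
  obtain ⟨e, he, h⟩ := exists_ne_zero_of_one_mem_vOp hφ hD
    ((one_mem_vOp_coeSubmodule hJ.ne_bot hJ.fg).2 hJ)
  obtain ⟨r, hr, rfl⟩ := (IsLocalization.mem_coeSubmodule K J).1 he
  exact ⟨r, hr, h r rfl⟩

theorem algebraMap_mem_vOp_restrictScalars {E : Submodule T K}
    (h : 1 ∈ vOp (D.comap φ) K (E.restrictScalars _)) (t : T) :
    algebraMap T K t ∈ vOp (D.comap φ) K (E.restrictScalars _) := by
  refine mem_vOp.2 fun y hy => ?_
  rw [mul_comm]
  refine one_mem_vOp.1 h _ fun e he => ?_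
  rw [mul_assoc, mul_comm (algebraMap T K t)]
  exact hy _ (mul_algebraMap_mem (E := E) he t)

theorem algebraMap_mem_wOp_restrictScalars {E : Submodule T K}
    (h : 1 ∈ wOp (D.comap φ) K (E.restrictScalars _)) (t : T) :
    algebraMap T K t ∈ wOp (D.comap φ) K (E.restrictScalars _) := by
  intro P hP hmax
  obtain ⟨s, hs, hsx⟩ := h P hP hmax
  refine ⟨s, hs, ?_⟩
  rw [← one_mul (algebraMap T K t), ← smul_mul_assoc]
  exact mul_algebraMap_mem (E := E) hsx t

theorem algebraMap_mem_tOp_restrictScalars {E : Submodule T K}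
    (h : 1 ∈ tOp (D.comap φ) K (E.restrictScalars _)) (t : T) :
    algebraMap T K t ∈ tOp (D.comap φ) K (E.restrictScalars _) := by
  obtain ⟨F, hF0, hFfg, hF, h1⟩ := h
  -- The witness `F` is replaced by `tF`, which is zero when `t = 0`.
  by_cases ht : t = 0
  · refine ⟨F, hF0, hFfg, hF, subset_vOp ?_⟩
    simp [ht]
  have ht' : algebraMap T K t ≠ 0 := by simpa using ht
  refine ⟨F.map (LinearMap.mulLeft _ (algebraMap T K t)), ?_, hFfg.map _, ?_, ?_⟩
  · obtain ⟨e, he, he0⟩ := Submodule.exists_mem_ne_zero_of_ne_bot hF0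
    exact (Submodule.ne_bot_iff _).2 ⟨_, Submodule.mem_map_of_mem he, mul_ne_zero ht' he0⟩
  · rintro _ ⟨e, he, rfl⟩
    rw [LinearMap.mulLeft_apply, mul_comm]
    exact mul_algebraMap_mem (E := E) (hF he) t
  · refine mem_vOp.2 fun y hy => ?_
    rw [mul_comm]
    refine one_mem_vOp.1 h1 _ fun e he => ?_
    rw [mul_assoc]
    exact hy _ (Submodule.mem_map_of_mem (f := LinearMap.mulLeft _ (algebraMap T K t)) he)

/-- With `ju + m = 1` and `m ∈ ker φ`, the elements `ju` and `ms`, for generators `s` of `J`, lie in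
`J ∩ R` and generate a GV ideal of `R`: an `x` sending them into `R` lies in `T`, and then `φ(x) =
φ(x·ju) ∈ D`. -/
theorem one_mem_wOp_of_isGVIdeal [IsFractionRing (D.comap φ) K] (hφ : Function.Surjective φ)
    {J : Ideal T} (hJ : IsGVIdeal K J) {j : T} (hjJ : j ∈ J) (hj : φ j ≠ 0) :
    1 ∈ wOp (D.comap φ) K ((IsLocalization.coeSubmodule K J).restrictScalars _) := by
  classical
  obtain ⟨u, m, hm, hum⟩ := exists_one_eq_mul_add hφ hj
  obtain ⟨S, rfl⟩ := hJ.fg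
  have hf : φ (j * u) = 1 := by simpa [hm] using congrArg φ hum
  set f : D.comap φ := ⟨j * u, by simp [Subring.mem_comap, hf, D.one_mem]⟩ with hfdef
  set g : T → D.comap φ := fun s => ⟨m * s, by simp [Subring.mem_comap, hm, D.zero_mem]⟩
  set G : Ideal (D.comap φ) := Ideal.span (insert f (g '' S)) with hG
  have hfG : f ∈ G := Ideal.subset_span (Set.mem_insert _ _)
  have hgG : ∀ s ∈ S, g s ∈ G := fun s hs =>
    Ideal.subset_span (Set.mem_insert_of_mem _ ⟨s, hs, rfl⟩)
  have hGV : IsGVIdeal K G := by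
    refine ⟨(Submodule.ne_bot_iff _).2 ⟨f, hfG, fun h0 => ?_⟩,
      Submodule.fg_span ((S.finite_toSet.image g).insert f), fun x hx => ?_⟩
    · have : j * u = 0 := congrArg Subtype.val h0
      simp [this] at hf
    · have hxf := hx f hfG
      have hx1 : x ∈ (1 : Submodule T K) := mem_one_of_isGVIdeal_span hJ (h := j * u) (t := 1)
        (by rwa [mul_one]) (mem_one_of_mem_one_comap hxf)
        fun s hs => mem_one_of_mem_one_comap (hx (g s) (hgG s hs))
      obtain ⟨t, rfl⟩ := Submodule.mem_one.1 hx1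
      have : algebraMap T K (t * (j * u)) ∈ (1 : Submodule (D.comap φ) K) := by
        rw [map_mul]; exact hxf
      rw [algebraMap_mem_one_comap, map_mul, hf, mul_one] at this
      exact algebraMap_mem_one_comap.2 this
  have hGJ : G ≤ (Ideal.span (S : Set T)).comap (D.comap φ).subtype := by
    rw [hG, Ideal.span_le]
    rintro _ (rfl | ⟨s, hs, rfl⟩)
    · exact Ideal.mul_mem_right _ _ hjJ
    · exact Ideal.mul_mem_left _ _ (Ideal.subset_span hs)
  refine (mem_wOp ?_).2 ⟨G, hGV, fun a ha => ?_⟩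
  · rw [Ne, Submodule.restrictScalars_eq_bot_iff]
    exact coeSubmodule_ne_bot hJ.ne_bot
  · rw [one_mul]
    exact (IsLocalization.mem_coeSubmodule K _).2 ⟨a, hGJ ha, rfl⟩

/-- The right side does not mention `star`: all that matters is that, for membership of 1, `star`
lies between `w` and `v` on `T`-modules. -/
theorem isPStarMD_extendOp_iff (hφ : Function.Surjective φ) (hD : D ≠ ⊤)
    [IsFractionRing (D.comap φ) K] {star : Submodule (D.comap φ) K → Set K}
    (hmul : ∀ E : Submodule T K, 1 ∈ star (E.restrictScalars _) → ∀ t : T,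
      algebraMap T K t ∈ star (E.restrictScalars _))
    (hw : ∀ E : Submodule T K, E ≠ ⊥ → 1 ∈ wOp (D.comap φ) K (E.restrictScalars _) →
      1 ∈ star (E.restrictScalars _))
    (hv : ∀ E : Submodule T K, E ≠ ⊥ → 1 ∈ star (E.restrictScalars _) →
      1 ∈ vOp (D.comap φ) K (E.restrictScalars _)) :
    IsPStarMD (extendOp T star) ↔ ∀ I : Submodule T K, I ≠ ⊥ → I.FG → ∃ J : Ideal T,
      IsGVIdeal K J ∧ (∃ j ∈ J, φ j ≠ 0) ∧ ∀ a ∈ J, algebraMap T K a ∈ I * (1 / I) := by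
  rw [isPStarMD_iff (star := extendOp T star)
    (fun F _ _ hF => Set.inter_subset_right.trans (vOp_subset_one hF))
    fun F hF a => ⟨hmul F hF.1 a, by simpa using mul_mem_vOp hF.2 a⟩]
  refine forall_congr' fun I => forall_congr' fun _ => forall_congr' fun _ =>
    exists_congr fun J => ?_
  rw [SetLike.le_def, forall_mem_coeSubmodule]
  constructor
  · rintro ⟨h0, hfg, hle, h1, h2⟩
    refine ⟨(one_mem_vOp_coeSubmodule h0 hfg).1 h2, ?_, hle⟩
    obtain ⟨e, he, h⟩ := exists_ne_zero_of_one_mem_vOp hφ hD (hv _ (coeSubmodule_ne_bot h0) h1)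
    obtain ⟨j, hj, rfl⟩ := (IsLocalization.mem_coeSubmodule K J).1 he
    exact ⟨j, hj, h j rfl⟩
  · rintro ⟨hJ, ⟨j, hjJ, hj⟩, hle⟩
    exact ⟨hJ.ne_bot, hJ.fg, hle, hw _ (coeSubmodule_ne_bot hJ.ne_bot)
      (one_mem_wOp_of_isGVIdeal hφ hJ hjJ hj), (one_mem_vOp_coeSubmodule hJ.ne_bot hJ.fg).2 hJ⟩

variable [IsFractionRing (D.comap φ) K]

theorem one_mem_tOp_restrictScalars (E : Submodule T K) (hE : E ≠ ⊥)
    (h : 1 ∈ wOp (D.comap φ) K (E.restrictScalars _)) :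
    1 ∈ tOp (D.comap φ) K (E.restrictScalars _) :=
  one_mem_tOp_of_one_mem_wOp (by rwa [Ne, Submodule.restrictScalars_eq_bot_iff]) h

theorem isPStarMD_extendOp_vOp_iff (hφ : Function.Surjective φ) (hD : D ≠ ⊤) :
    IsPStarMD (extendOp T (vOp (D.comap φ) K)) ↔
    ∀ I : Submodule T K, I ≠ ⊥ → I.FG → ∃ J : Ideal T, IsGVIdeal K J ∧ (∃ j ∈ J, φ j ≠ 0) ∧
      ∀ a ∈ J, algebraMap T K a ∈ I * (1 / I) :=
  isPStarMD_extendOp_iff hφ hD (fun _ => algebraMap_mem_vOp_restrictScalars)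
    (fun E hE h => tOp_subset_vOp _ (one_mem_tOp_restrictScalars E hE h)) fun _ _ h => h

theorem isPStarMD_extendOp_vOp_iff_tOp (hφ : Function.Surjective φ) (hD : D ≠ ⊤) :
    IsPStarMD (extendOp T (vOp (D.comap φ) K)) ↔
      IsPStarMD (extendOp T (tOp (D.comap φ) K)) := by
  rw [isPStarMD_extendOp_vOp_iff hφ hD, isPStarMD_extendOp_iff hφ hD
    (fun _ => algebraMap_mem_tOp_restrictScalars) one_mem_tOp_restrictScalars
    fun _ _ h => tOp_subset_vOp _ h]

theorem isPStarMD_extendOp_vOp_iff_wOp (hφ : Function.Surjective φ) (hD : D ≠ ⊤) :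
    IsPStarMD (extendOp T (vOp (D.comap φ) K)) ↔
      IsPStarMD (extendOp T (wOp (D.comap φ) K)) := by
  rw [isPStarMD_extendOp_vOp_iff hφ hD, isPStarMD_extendOp_iff hφ hD
    (fun _ => algebraMap_mem_wOp_restrictScalars) (fun _ _ h => h)
    fun E hE h => tOp_subset_vOp _ (one_mem_tOp_restrictScalars E hE h)]

end Pullback

/-! ### Transfer of the PvMD property between `R`, `T` and `D`. -/

section PullbackPvMD

variable {T : Type*} (K : Type*) {k : Type*} [CommRing T] [Field K] [Algebra T K] [Field k]
  (φ : T →+* k) {D : Subring k}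

/-- The preimage `φ⁻¹(E)` of a `D`-submodule `E` of `k`, as an `R`-submodule of `K`, where
`R = φ⁻¹(D)`. -/
def comapSubmodule (E : Submodule D k) : Submodule (D.comap φ) K where
  carrier := {x | ∃ t : T, φ t ∈ E ∧ algebraMap T K t = x}
  add_mem' := by
    rintro _ _ ⟨s, hs, rfl⟩ ⟨t, ht, rfl⟩
    exact ⟨s + t, by rw [map_add]; exact E.add_mem hs ht, map_add _ _ _⟩
  zero_mem' := ⟨0, by simp, map_zero _⟩
  smul_mem' := by
    rintro r _ ⟨t, ht, rfl⟩
    refine ⟨r * t, ?_, by rw [map_mul, Algebra.smul_def]; rfl⟩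
    rw [map_mul]
    exact E.smul_mem ⟨φ r, r.2⟩ ht

variable {K φ}

theorem comapSubmodule_mul_le (E E' : Submodule D k) :
    comapSubmodule K φ E * comapSubmodule K φ E' ≤ comapSubmodule K φ (E * E') := by
  rw [Submodule.mul_le]
  rintro _ ⟨s, hs, rfl⟩ _ ⟨t, ht, rfl⟩
  exact ⟨s * t, by rw [map_mul]; exact Submodule.mul_mem_mul hs ht, map_mul _ _ _⟩

variable [IsDomain T] [IsFractionRing T K]

theorem algebraMap_mem_comapSubmodule {E : Submodule D k} {t : T} :
    algebraMap T K t ∈ comapSubmodule K φ E ↔ φ t ∈ E := by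
  refine ⟨fun ⟨s, hs, hst⟩ => ?_, fun h => ⟨t, h, rfl⟩⟩
  rwa [← IsFractionRing.injective T K hst]

theorem algebraMap_mem_one_comap_mul {s t : T} :
    algebraMap T K s * algebraMap T K t ∈ (1 : Submodule (D.comap φ) K) ↔ φ s * φ t ∈ D := by
  rw [← map_mul, algebraMap_mem_one_comap, map_mul]

theorem mem_subring_one {y : k} : y ∈ (1 : Submodule D k) ↔ y ∈ D := by
  rw [Submodule.mem_one]
  exact ⟨fun ⟨d, hd⟩ => hd ▸ d.2, fun h => ⟨⟨y, h⟩, rfl⟩⟩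

/-- The products of generators with elements of the inverse span `I I⁻¹` over `T`; if all lay in
`ker φ`, so would `j`. -/
theorem exists_mul_eq_algebraMap_of_mem {S : Set K} {j : T} (hj : φ j ≠ 0)
    (h : algebraMap T K j ∈ Submodule.span T S * (1 / Submodule.span T S)) :
    ∃ i ∈ S, ∃ z ∈ (1 / Submodule.span T S : Submodule T K), ∃ t : T,
      algebraMap T K t = z * i ∧ φ t ≠ 0 := by
  by_contra! hc
  have hle : Submodule.span T S * (1 / Submodule.span T S) ≤
      IsLocalization.coeSubmodule K (RingHom.ker φ) := by
    rw [Submodule.mul_le]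
    intro i hi z hz
    induction hi using Submodule.span_induction with
    | mem i hi =>
      obtain ⟨t, ht⟩ := Submodule.mem_one.1
        (Submodule.mem_div_iff_forall_mul_mem.1 hz i (Submodule.subset_span hi))
      exact (IsLocalization.mem_coeSubmodule K _).2 ⟨t, hc i hi z hz t ht, by rw [ht, mul_comm]⟩
    | zero => simp
    | add a b _ _ ha hb => rw [add_mul]; exact add_mem ha hb
    | smul c a _ ha => rw [smul_mul_assoc]; exact Submodule.smul_mem _ c ha
  obtain ⟨m, hm, hmj⟩ := (IsLocalization.mem_coeSubmodule K _).1 (hle h)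
  rw [← IsFractionRing.injective T K hmj] at hj
  exact hj hm

/-- For `I = R + Rt`, if `φ(t)` is not a fraction over `D`, then `I⁻¹ ⊆ ker φ`. As `I ⊆ T`, also `I
I⁻¹ ⊆ ker φ`, which contains no GV ideal of `R`. -/
theorem isFractionRing_of_isPStarMD [IsFractionRing (D.comap φ) K]
    (hφ : Function.Surjective φ) (hD : D ≠ ⊤) (h : IsPStarMD (vOp (D.comap φ) K)) :
    IsFractionRing D k := by
  rw [isPStarMD_vOp_iff] at h
  suffices hy : ∀ y : k, ∃ d ∈ D, d ≠ 0 ∧ y * d ∈ D by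
    refine IsFractionRing.of_field D k fun y => ?_
    obtain ⟨d, hd, h0, hyd⟩ := hy y
    exact ⟨⟨y * d, hyd⟩, ⟨d, hd⟩, (mul_div_cancel_right₀ y h0).symm⟩
  intro y
  by_contra! hc
  obtain ⟨t, rfl⟩ := hφ y
  set I : Submodule (D.comap φ) K := Submodule.span _ {1, algebraMap T K t} with hI
  have h1I : (1 : K) ∈ I := Submodule.subset_span (by simp)
  have htI : algebraMap T K t ∈ I := Submodule.subset_span (by simp)
  obtain ⟨J, hJ, hJI⟩ := h I ((Submodule.ne_bot_iff _).2 ⟨1, h1I, one_ne_zero⟩)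
    (Submodule.fg_span (by simp))
  obtain ⟨r, hr, hr0⟩ := hJ.exists_map_ne_zero hφ hD
  have hI1 : I ≤ (1 : Submodule T K).restrictScalars _ := by
    rw [hI, Submodule.span_le]
    rintro x (rfl | rfl)
    · exact Submodule.mem_one.2 ⟨1, map_one _⟩
    · exact algebraMap_mem_submoduleOne t
  have hle : I * (1 / I) ≤ comapSubmodule K φ ⊥ := by
    rw [Submodule.mul_le]
    intro i hi z hz
    have hz1 := Submodule.mem_div_iff_forall_mul_mem.1 hz 1 h1I
    rw [mul_one] at hz1
    obtain ⟨s, hs, rfl⟩ := mem_one_comap.1 hz1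
    have hst := Submodule.mem_div_iff_forall_mul_mem.1 hz _ htI
    rw [algebraMap_mem_one_comap_mul, mul_comm] at hst
    have hs0 : φ s = 0 := by
      by_contra h0
      exact hc _ hs h0 hst
    obtain ⟨u, rfl⟩ := Submodule.mem_one.1 (hI1 hi)
    rw [← map_mul, algebraMap_mem_comapSubmodule]
    simp [hs0]
  exact hr0 ((Submodule.mem_bot _).1 (algebraMap_mem_comapSubmodule.1 (hle (hJI r hr))))

theorem isPStarMD_extendOp_of_isPStarMD [IsFractionRing (D.comap φ) K]
    (hφ : Function.Surjective φ) (hD : D ≠ ⊤) (h : IsPStarMD (vOp (D.comap φ) K)) :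
    IsPStarMD (extendOp T (vOp (D.comap φ) K)) := by
  rw [isPStarMD_vOp_iff] at h
  rw [isPStarMD_extendOp_vOp_iff hφ hD]
  rintro _ hI0 ⟨S, rfl⟩
  obtain ⟨J, hJ, hJI⟩ := h (Submodule.span _ S)
    (fun hb => hI0 (by simpa [Submodule.span_eq_bot] using hb)) ⟨S, rfl⟩
  obtain ⟨r, hr, hr0⟩ := hJ.exists_map_ne_zero hφ hD
  have hrJ : (r : T) ∈ J.map (D.comap φ).subtype := Ideal.mem_map_of_mem (D.comap φ).subtype hr
  refine ⟨J.map (D.comap φ).subtype, ⟨?_, Ideal.FG.map hJ.fg _, fun x hx => ?_⟩, ⟨r, hrJ, hr0⟩, ?_⟩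
  · refine (Submodule.ne_bot_iff _).2 ⟨r, hrJ, fun h0 => hr0 ?_⟩
    rw [h0, map_zero]
  -- If `xJ ⊆ T`, then `xmJ ⊆ ker φ ⊆ R` gives `xm ∈ R`; with `xr ∈ T` and `rt + m = 1` this yields
  -- `x ∈ T`.
  · obtain ⟨t, m, hm, htm⟩ := exists_one_eq_mul_add hφ hr0
    have hxm : x * algebraMap T K m ∈ (1 : Submodule (D.comap φ) K) := by
      refine hJ.mem_one _ fun a ha => ?_
      obtain ⟨s, hs⟩ := Submodule.mem_one.1 (hx a (Ideal.mem_map_of_mem (D.comap φ).subtype ha))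
      change x * algebraMap T K m * algebraMap T K a ∈ _
      rw [mul_right_comm, ← hs, algebraMap_mem_one_comap_mul, hm, mul_zero]
      exact D.zero_mem
    have : x = x * algebraMap T K r * algebraMap T K t + x * algebraMap T K m := by
      rw [mul_assoc, ← map_mul, ← mul_add, ← map_add, htm, map_one, mul_one]
    rw [this]
    exact add_mem (mul_algebraMap_mem (hx _ hrJ) t) (mem_one_of_mem_one_comap hxm)
  · set I' := Submodule.span T (S : Set K)
    set I := Submodule.span (D.comap φ) (S : Set K)
    have hinv : ∀ z ∈ 1 / I, z ∈ 1 / I' := by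
      intro z hz
      refine Submodule.mem_div_iff_forall_mul_mem.2 fun j hj => ?_
      induction hj using Submodule.span_induction with
      | mem j hj =>
        exact mem_one_of_mem_one_comap
          (Submodule.mem_div_iff_forall_mul_mem.1 hz j (Submodule.subset_span hj))
      | zero => simp
      | add a b _ _ ha hb => rw [mul_add]; exact add_mem ha hb
      | smul c a _ ha => rw [mul_smul_comm]; exact Submodule.smul_mem _ c ha
    have hII' : ∀ x ∈ I * (1 / I), x ∈ I' * (1 / I') := by
      intro x hx
      induction hx using Submodule.mul_induction_on' with
      | mem_mul_mem i hi z hz =>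
        exact Submodule.mul_mem_mul (Submodule.span_le_restrictScalars (D.comap φ) T _ hi)
          (hinv z hz)
      | add a _ b _ ha hb => exact add_mem ha hb
    have hle : J.map (D.comap φ).subtype ≤ (I' * (1 / I')).comap (Algebra.linearMap T K) :=
      Ideal.map_le_iff_le_comap.2 fun a ha => hII' (algebraMap T K a) (hJI a ha)
    exact fun a ha => hle ha

/-- Some `z` in the inverse of `(a, b)` has `za` or `zb` outside `ker φ`; the relation is `a(zb) =
b(za)`. -/
theorem exists_mul_eq_mul_of_isPStarMD_extendOp [IsFractionRing (D.comap φ) K]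
    (hφ : Function.Surjective φ) (hD : D ≠ ⊤)
    (h : IsPStarMD (extendOp T (vOp (D.comap φ) K))) (a b : T) :
    ∃ r t : T, φ t ≠ 0 ∧ (a * r = b * t ∨ b * r = a * t) := by
  rw [isPStarMD_extendOp_vOp_iff hφ hD] at h
  by_cases ha : a = 0
  · exact ⟨0, 1, by simp, Or.inr (by simp [ha])⟩
  have haS : algebraMap T K a ∈ Submodule.span T {algebraMap T K a, algebraMap T K b} :=
    Submodule.subset_span (by simp)
  have hbS : algebraMap T K b ∈ Submodule.span T {algebraMap T K a, algebraMap T K b} :=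
    Submodule.subset_span (by simp)
  obtain ⟨J, -, ⟨j, hjJ, hj⟩, hJ⟩ := h (Submodule.span T {algebraMap T K a, algebraMap T K b})
    ((Submodule.ne_bot_iff _).2 ⟨_, haS, by simpa using ha⟩) (Submodule.fg_span (by simp))
  obtain ⟨i, hi, z, hz, t, ht, ht0⟩ := exists_mul_eq_algebraMap_of_mem hj (hJ j hjJ)
  obtain ⟨u, hu⟩ := Submodule.mem_one.1 (Submodule.mem_div_iff_forall_mul_mem.1 hz _ haS)
  obtain ⟨v, hv⟩ := Submodule.mem_one.1 (Submodule.mem_div_iff_forall_mul_mem.1 hz _ hbS)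
  have key : a * v = b * u := by
    apply IsFractionRing.injective T K
    rw [map_mul, map_mul, hu, hv]
    ring
  obtain rfl | rfl := hi
  · rw [← hu] at ht
    rw [IsFractionRing.injective T K ht] at ht0
    exact ⟨v, u, ht0, Or.inl key⟩
  · rw [← hv] at ht
    rw [IsFractionRing.injective T K ht] at ht0
    exact ⟨u, v, ht0, Or.inr key.symm⟩

theorem isPStarMD_residue_of_isPStarMD [IsFractionRing (D.comap φ) K] [IsFractionRing D k]
    (hφ : Function.Surjective φ) (hD : D ≠ ⊤) (h : IsPStarMD (vOp (D.comap φ) K)) :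
    IsPStarMD (vOp D k) := by
  classical
  rw [isPStarMD_vOp_iff] at h ⊢
  rintro _ hE0 ⟨S, rfl⟩
  obtain ⟨y, hyS, hy0⟩ : ∃ y ∈ S, y ≠ 0 := by
    by_contra! hc
    exact hE0 (Submodule.span_eq_bot.2 hc)
  obtain ⟨σ, hσ⟩ := hφ.hasRightInverse
  obtain ⟨u, m, hm, hum⟩ := exists_one_eq_mul_add hφ (h := σ y) (by rwa [hσ])
  set E := Submodule.span D (S : Set k) with hE
  -- Adjoining `m` to the lifts forces `I⁻¹ ⊆ T`, since `σ(y)u + m = 1`; it leaves `φ(I) = E`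
  -- unchanged.
  set I : Submodule (D.comap φ) K := Submodule.span _
    (insert (algebraMap T K m) ((fun s => algebraMap T K (σ s)) '' S)) with hI
  have hmI : algebraMap T K m ∈ I := Submodule.subset_span (Set.mem_insert _ _)
  have hσI : ∀ s ∈ S, algebraMap T K (σ s) ∈ I := fun s hs =>
    Submodule.subset_span (Set.mem_insert_of_mem _ ⟨s, hs, rfl⟩)
  have hIE : I ≤ comapSubmodule K φ E := by
    rw [hI, Submodule.span_le]
    rintro _ (rfl | ⟨s, hs, rfl⟩)
    · exact ⟨m, by simp [hm], rfl⟩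
    · exact ⟨σ s, by rw [hσ]; exact Submodule.subset_span hs, rfl⟩
  have hIE' : 1 / I ≤ comapSubmodule K φ (1 / E) := by
    intro z hz
    rw [Submodule.mem_div_iff_forall_mul_mem] at hz
    have hz1 : z ∈ (1 : Submodule T K) := by
      have : z = z * algebraMap T K (σ y) * algebraMap T K u + z * algebraMap T K m := by
        rw [mul_assoc, ← map_mul, ← mul_add, ← map_add, hum, map_one, mul_one]
      rw [this]
      exact add_mem (mul_algebraMap_mem (mem_one_of_mem_one_comap (hz _ (hσI y hyS))) u)
        (mem_one_of_mem_one_comap (hz _ hmI))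
    obtain ⟨w, rfl⟩ := Submodule.mem_one.1 hz1
    refine algebraMap_mem_comapSubmodule.2
      (Submodule.mem_div_iff_forall_mul_mem.2 fun e he => ?_)
    induction he using Submodule.span_induction with
    | mem s hs =>
      rw [mem_subring_one, ← hσ s, ← algebraMap_mem_one_comap_mul (K := K)]
      exact hz _ (hσI s hs)
    | zero => simp
    | add a b _ _ ha hb => rw [mul_add]; exact add_mem ha hb
    | smul c a _ ha => rw [mul_smul_comm]; exact Submodule.smul_mem _ c ha
  obtain ⟨F, hF, hFI⟩ := h I
    ((Submodule.ne_bot_iff _).2 ⟨_, hσI y hyS, fun h0 => hy0 (by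
      have : σ y = 0 := by simpa using h0
      rw [← hσ y, this, map_zero])⟩)
    (Submodule.fg_span ((S.finite_toSet.image _).insert _))
  set ψ : D.comap φ →+* D := φ.restrict (D.comap φ) D fun _ hx => hx with hψ
  have hψs : Function.Surjective ψ := by
    rintro ⟨d, hd⟩
    obtain ⟨t, rfl⟩ := hφ d
    exact ⟨⟨t, hd⟩, rfl⟩
  refine ⟨F.map ψ, ⟨?_, Ideal.FG.map hF.fg _, fun x hx => ?_⟩, fun a ha => ?_⟩
  · obtain ⟨r, hr, hr0⟩ := hF.exists_map_ne_zero hφ hD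
    exact (Submodule.ne_bot_iff _).2 ⟨ψ r, Ideal.mem_map_of_mem ψ hr,
      fun h0 => hr0 (congrArg Subtype.val h0)⟩
  · obtain ⟨t, rfl⟩ := hφ x
    rw [mem_subring_one, ← algebraMap_mem_one_comap (K := K)]
    refine hF.mem_one _ fun a ha => ?_
    exact algebraMap_mem_one_comap_mul.2 (mem_subring_one.1 (hx _ (Ideal.mem_map_of_mem ψ ha)))
  · obtain ⟨r, hr, rfl⟩ := (Ideal.mem_map_iff_of_surjective ψ hψs).1 ha
    have hII : I * (1 / I) ≤ comapSubmodule K φ E * comapSubmodule K φ (1 / E) :=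
      Submodule.mul_le.2 fun i hi z hz => Submodule.mul_mem_mul (hIE hi) (hIE' hz)
    have hr' : algebraMap T K r ∈ I * (1 / I) := hFI r hr
    have : φ r ∈ E * (1 / E) :=
      algebraMap_mem_comapSubmodule.1 (comapSubmodule_mul_le E (1 / E) (hII hr'))
    exact this

theorem isPStarMD_of_isPStarMD_residue [IsFractionRing (D.comap φ) K] [IsFractionRing D k]
    (hφ : Function.Surjective φ) (hD : D ≠ ⊤) (hDk : IsPStarMD (vOp D k))
    (hT : IsPStarMD (extendOp T (vOp (D.comap φ) K))) : IsPStarMD (vOp (D.comap φ) K) := by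
  classical
  rw [isPStarMD_vOp_iff] at hDk ⊢
  rw [isPStarMD_extendOp_vOp_iff hφ hD] at hT
  rintro _ hI0 ⟨S, rfl⟩
  set I := Submodule.span (D.comap φ) (S : Set K) with hI
  set I' := Submodule.span T (S : Set K) with hI'
  have hII' : ∀ i ∈ I, i ∈ I' := fun i hi => Submodule.span_le_restrictScalars (D.comap φ) T _ hi
  obtain ⟨_, hG, ⟨j, hjG, hj⟩, hGI'⟩ := hT I'
    (fun hb => hI0 (by simpa [hI, hI', Submodule.span_eq_bot] using hb)) ⟨S, rfl⟩
  obtain ⟨SG, rfl⟩ := hG.fg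
  -- Multiplication by `z` moves `I` into `T` but not into `ker φ`, so `E = φ(zI)` is a nonzero
  -- finitely generated `D`-module.
  obtain ⟨i₀, hi₀, z, hz, t₀, ht₀, hφt₀⟩ := exists_mul_eq_algebraMap_of_mem hj (hGI' j hjG)
  have hq : ∀ x : K, ∃ t : T, x ∈ I' → algebraMap T K t = z * x := fun x => by
    by_cases hx : x ∈ I'
    · obtain ⟨t, ht⟩ := Submodule.mem_one.1 (Submodule.mem_div_iff_forall_mul_mem.1 hz x hx)
      exact ⟨t, fun _ => ht⟩
    · exact ⟨0, fun h => absurd h hx⟩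
  choose q hq using hq
  set E : Submodule D k := Submodule.span D ((fun x => φ (q x)) '' S) with hE
  have hqE : ∀ s ∈ S, φ (q s) ∈ E := fun s hs => Submodule.subset_span ⟨s, hs, rfl⟩
  have hqI' : ∀ s ∈ S, algebraMap T K (q s) = z * s := fun s hs =>
    hq s (Submodule.subset_span hs)
  have hzI : ∀ i ∈ I, z * i ∈ comapSubmodule K φ E := by
    intro i hi
    induction hi using Submodule.span_induction with
    | mem s hs => exact ⟨q s, hqE s hs, hqI' s hs⟩
    | zero => simp
    | add a b _ _ ha hb => rw [mul_add]; exact add_mem ha hb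
    | smul c a _ ha => rw [mul_smul_comm]; exact Submodule.smul_mem _ c ha
  have hEI : ∀ e ∈ E, ∃ i ∈ I, ∃ t : T, algebraMap T K t = z * i ∧ φ t = e := by
    intro e he
    induction he using Submodule.span_induction with
    | mem e he =>
      obtain ⟨s, hs, rfl⟩ := he
      exact ⟨s, Submodule.subset_span hs, q s, hqI' s hs, rfl⟩
    | zero => exact ⟨0, zero_mem _, 0, by simp, by simp⟩
    | add a b _ _ ha hb =>
      obtain ⟨i, hi, t, ht, rfl⟩ := ha
      obtain ⟨i', hi', t', ht', rfl⟩ := hb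
      exact ⟨i + i', add_mem hi hi', t + t', by rw [map_add, ht, ht', mul_add], map_add _ _ _⟩
    | smul c a _ ha =>
      obtain ⟨i, hi, t, ht, rfl⟩ := ha
      obtain ⟨c, hc⟩ := c
      obtain ⟨r, rfl⟩ := hφ c
      refine ⟨(⟨r, hc⟩ : D.comap φ) • i, Submodule.smul_mem _ _ hi, r * t, ?_, map_mul _ _ _⟩
      rw [map_mul, ht, mul_left_comm, Algebra.smul_def]
      rfl
  have hinv : ∀ w : T, φ w ∈ 1 / E → z * algebraMap T K w ∈ 1 / I := by
    intro w hw
    refine Submodule.mem_div_iff_forall_mul_mem.2 fun i hi => ?_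
    obtain ⟨t, ht, hti⟩ := hzI i hi
    rw [mul_right_comm, ← hti, algebraMap_mem_one_comap_mul, mul_comm]
    exact mem_subring_one.1 (Submodule.mem_div_iff_forall_mul_mem.1 hw _ ht)
  have hlift : ∀ e ∈ E * (1 / E), ∃ r : T, algebraMap T K r ∈ I * (1 / I) ∧ φ r = e := by
    intro e he
    induction he using Submodule.mul_induction_on' with
    | mem_mul_mem e he y hy =>
      obtain ⟨i, hi, t, ht, rfl⟩ := hEI e he
      obtain ⟨w, rfl⟩ := hφ y
      refine ⟨t * w, ?_, map_mul _ _ _⟩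
      rw [map_mul, ht, mul_right_comm, mul_comm _ i]
      exact Submodule.mul_mem_mul hi (hinv w hy)
    | add a _ b _ ha hb =>
      obtain ⟨r, hr, rfl⟩ := ha
      obtain ⟨r', hr', rfl⟩ := hb
      exact ⟨r + r', by rw [map_add]; exact add_mem hr hr', map_add _ _ _⟩
  have hker : ∀ m : T, φ m = 0 → ∀ x ∈ I' * (1 / I'), algebraMap T K m * x ∈ I * (1 / I) := by
    intro m hm x hx
    induction hx using Submodule.mul_induction_on' with
    | mem_mul_mem i hi v hv =>
      induction hi using Submodule.span_induction generalizing v with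
      | mem s hs =>
        rw [mul_left_comm]
        refine Submodule.mul_mem_mul (Submodule.subset_span hs)
          (Submodule.mem_div_iff_forall_mul_mem.2 fun i hi => ?_)
        obtain ⟨t, ht⟩ := Submodule.mem_one.1
          (Submodule.mem_div_iff_forall_mul_mem.1 hv i (hII' i hi))
        rw [mul_assoc, ← ht, algebraMap_mem_one_comap_mul, hm, zero_mul]
        exact D.zero_mem
      | zero => simp
      | add a b _ _ ha hb => rw [add_mul, mul_add]; exact add_mem (ha v hv) (hb v hv)
      | smul c a _ ha =>
        -- `I (1 / I)` is only an `R`-module, so the scalar `c ∈ T` is absorbed into `v`, which is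
        -- why `v` is generalized.
        rw [smul_mul_assoc, ← mul_smul_comm]
        exact ha _ (Submodule.smul_mem _ c hv)
    | add a _ b _ ha hb => rw [mul_add]; exact add_mem ha hb
  obtain ⟨_, hH, hHE⟩ := hDk E
    ((Submodule.ne_bot_iff _).2 ⟨φ (q i₀), hqE i₀ hi₀, fun h0 => hφt₀ (by
      rwa [IsFractionRing.injective T K (ht₀.trans (hqI' i₀ hi₀).symm)])⟩)
    (Submodule.fg_span (S.finite_toSet.image _))
  obtain ⟨SH, rfl⟩ := hH.fg
  have hr : ∀ d : D, ∃ r : D.comap φ, φ r = d ∧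
      (d ∈ Ideal.span (SH : Set D) → algebraMap T K r ∈ I * (1 / I)) := by
    rintro ⟨d, hd⟩
    by_cases hdH : (⟨d, hd⟩ : D) ∈ Ideal.span (SH : Set D)
    · obtain ⟨r, hrI, rfl⟩ := hlift _ (hHE _ hdH)
      exact ⟨⟨r, hd⟩, rfl, fun _ => hrI⟩
    · obtain ⟨r, rfl⟩ := hφ d
      exact ⟨⟨r, hd⟩, rfl, fun h => absurd h hdH⟩
  choose ρ hρ hρI using hr
  obtain ⟨d₀, hd₀, hd₀0⟩ : ∃ d ∈ SH, d ≠ 0 := by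
    by_contra! hc
    exact hH.ne_bot (Submodule.span_eq_bot.2 hc)
  have hρ0 : φ (ρ d₀) ≠ 0 := by
    rw [hρ]
    simpa using hd₀0
  obtain ⟨u, m, hm, hum⟩ := exists_one_eq_mul_add hφ hρ0
  set g : T → D.comap φ := fun s => ⟨m * s, by simp [Subring.mem_comap, hm, D.zero_mem]⟩
  -- The glued GV ideal: `ρ(d₀)` and `m·SG` force `x ∈ T`, then `ρ(SH)` forces `φ(x) ∈ D`.
  set F : Ideal (D.comap φ) := Ideal.span (ρ '' SH ∪ g '' SG) with hF
  have hρF : ∀ d ∈ SH, ρ d ∈ F := fun d hd => Ideal.subset_span (Or.inl ⟨d, hd, rfl⟩)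
  have hgF : ∀ s ∈ SG, g s ∈ F := fun s hs => Ideal.subset_span (Or.inr ⟨s, hs, rfl⟩)
  refine ⟨F, ⟨?_, Submodule.fg_span
    ((SH.finite_toSet.image ρ).union (SG.finite_toSet.image g)), fun x hx => ?_⟩, ?_⟩
  · refine (Submodule.ne_bot_iff _).2 ⟨_, hρF d₀ hd₀, fun h0 => hρ0 ?_⟩
    rw [h0]
    simp
  · have hx1 : x ∈ (1 : Submodule T K) := mem_one_of_isGVIdeal_span hG hum
      (mem_one_of_mem_one_comap (hx _ (hρF d₀ hd₀)))
      fun s hs => mem_one_of_mem_one_comap (hx _ (hgF s hs))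
    obtain ⟨t, rfl⟩ := Submodule.mem_one.1 hx1
    rw [algebraMap_mem_one_comap, ← mem_subring_one]
    refine hH.mem_one _ fun a ha => ?_
    induction ha using Submodule.span_induction with
    | mem d hd =>
      have : φ t * φ (ρ d) ∈ D := algebraMap_mem_one_comap_mul.1 (hx _ (hρF d hd))
      rw [hρ] at this
      exact mem_subring_one.2 this
    | zero => simp
    | add a b _ _ ha hb => rw [map_add, mul_add]; exact add_mem ha hb
    | smul c a _ ha =>
      rw [smul_eq_mul, map_mul, mul_left_comm, mul_comm]
      exact mul_algebraMap_mem ha c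
  · have hle : F ≤ (I * (1 / I)).comap (Algebra.linearMap (D.comap φ) K) := by
      rw [hF, Ideal.span_le]
      rintro _ (⟨d, hd, rfl⟩ | ⟨s, hs, rfl⟩)
      · exact hρI d (Ideal.subset_span hd)
      · change algebraMap T K (m * s) ∈ I * (1 / I)
        rw [map_mul]
        exact hker m hm _ (hGI' s (Ideal.subset_span hs))
    exact fun a ha => hle ha

end PullbackPvMD

/-! ### The valuation property at `M`, and the assembled equivalence. -/

theorem valuationRing_localization {T : Type*} [CommRing T] [IsDomain T] (M : Ideal T)
    [M.IsPrime] (h : ∀ a b : T, ∃ r t : T, t ∉ M ∧ (a * r = b * t ∨ b * r = a * t)) :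
    ValuationRing (Localization.AtPrime M) := by
  have key : ∀ (a b r t : T) (s u : M.primeCompl), t ∉ M → a * r = b * t →
      ∃ c, Localization.mk a s * c = Localization.mk b u := by
    intro a b r t s u ht hab
    refine ⟨Localization.mk (r * s) (u * ⟨t, ht⟩), ?_⟩
    rw [Localization.mk_mul, Localization.mk_eq_mk_iff, Localization.r_iff_exists]
    refine ⟨1, ?_⟩
    simp only [Submonoid.coe_mul, Submonoid.coe_one, one_mul]
    linear_combination (u * s : T) * hab
  refine { cond' := fun x y => ?_ }
  induction x using Localization.induction_on with | _ x
  induction y using Localization.induction_on with | _ y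
  obtain ⟨r, t, ht, h | h⟩ := h x.1 y.1
  · obtain ⟨c, hc⟩ := key x.1 y.1 r t x.2 y.2 ht h
    exact ⟨c, Or.inl hc⟩
  · obtain ⟨c, hc⟩ := key y.1 x.1 r t y.2 x.2 ht h
    exact ⟨c, Or.inr hc⟩

theorem mainTheorem6 {T K L : Type*} [CommRing T] [IsDomain T]
    [Field K] [Algebra T K] [IsFractionRing T K]
    (M : Ideal T) [M.IsMaximal] (hM : M ≠ ⊥)
    (D : Subring (T ⧸ M)) (hD : D ≠ ⊤)
    [Field L] [Algebra D L] [IsFractionRing D L] :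
    (IsPStarMD (vOp (pullbackRing M D) K) ↔
        (IsFractionRing D (T ⧸ M) ∧
          IsPStarMD (vOp D L) ∧
          IsPStarMD (extendOp T (vOp (pullbackRing M D) K)) ∧
          ValuationRing (Localization.AtPrime M))) ∧
      ((IsPStarMD (vOp (pullbackRing M D) K) ↔ IsPStarMD (tOp (pullbackRing M D) K)) ∧
        (IsPStarMD (vOp (pullbackRing M D) K) ↔ IsPStarMD (wOp (pullbackRing M D) K))) ∧
      ((IsPStarMD (vOp D L) ↔ IsPStarMD (tOp D L)) ∧
        (IsPStarMD (vOp D L) ↔ IsPStarMD (wOp D L))) ∧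
      ((IsPStarMD (extendOp T (vOp (pullbackRing M D) K)) ↔
          IsPStarMD (extendOp T (tOp (pullbackRing M D) K))) ∧
        (IsPStarMD (extendOp T (vOp (pullbackRing M D) K)) ↔
          IsPStarMD (extendOp T (wOp (pullbackRing M D) K)))) := by
  let : Field (T ⧸ M) := Ideal.Quotient.field M
  have := pullbackRing_isFractionRing (K := K) M hM D
  have hφ : Function.Surjective (Ideal.Quotient.mk M) := Ideal.Quotient.mk_surjective
  refine ⟨⟨fun h => ?_, fun ⟨hk, hDL, hT, _⟩ => ?_⟩,
    ⟨isPStarMD_vOp_iff_tOp, isPStarMD_vOp_iff_wOp⟩,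
    ⟨isPStarMD_vOp_iff_tOp, isPStarMD_vOp_iff_wOp⟩,
    isPStarMD_extendOp_vOp_iff_tOp hφ hD, isPStarMD_extendOp_vOp_iff_wOp hφ hD⟩
  · have hk : IsFractionRing D (T ⧸ M) := isFractionRing_of_isPStarMD hφ hD h
    have hT := isPStarMD_extendOp_of_isPStarMD hφ hD h
    refine ⟨hk, (isPStarMD_residue_of_isPStarMD hφ hD h).vOp_of_algEquiv
      (IsLocalization.algEquiv D⁰ (T ⧸ M) L), hT, valuationRing_localization M fun a b => ?_⟩
    obtain ⟨r, t, ht, h⟩ := exists_mul_eq_mul_of_isPStarMD_extendOp hφ hD hT a b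
    exact ⟨r, t, fun hM => ht (Ideal.Quotient.eq_zero_iff_mem.2 hM), h⟩
  · exact isPStarMD_of_isPStarMD_residue hφ hD
      (hDL.vOp_of_algEquiv (IsLocalization.algEquiv D⁰ L (T ⧸ M))) hT
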